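/- Let $\mathbf{x}=(x_1,x_2,\ldots)$ and $\mathbf{t}=(t_1,t_2,\ldots)$ be two infinite sequences of variables. **Forests.** An *indexed forest* is an infinite sequence $F=(T_1,T_2,\ldots)$ of binary plane trees (each node has either two children, a left and a right one, or none) of which all but finitely many are the one-node tree; $\mathsf{Forest}$ is the set of indexed forests, and $\emptyset$ is the forest all of whose trees have one node. The leaves of $F$ are labeled $1,2,3,\ldots$ from left to right. A node is *terminal* if it has two children and both are leaves. $\operatorname{Qdes}(F)$ is the set of the labels of the left children of the terminal nodes of $F$. For $i\in\operatorname{Qdes}(F)$ let $F/i$ be the indexed forest obtained from $F$ by replacing the terminal node whose left child has label $i$ by a leaf. **Operators.** For $f\in\mathbb Z[\mathbf t][\mathbf x]$ and $i\ge 1$ put $$\mathsf E_i f=\frac{f(x_1,\ldots,x_{i-1},x_i,t_i,x_{i+1},\ldots;\mathbf t)-f(x_1,\ldots,x_{i-1},t_i,x_i,x_{i+1},\ldots;\mathbf t)}{x_i-t_i}\in\mathbb Z[\mathbf t][\mathbf x],$$ and for $f\in\mathbb Z[\mathbf x]$ put $$\mathsf T_i f=\frac{f(x_1,\ldots,x_{i-1},x_i,0,x_{i+1},\ldots)-f(x_1,\ldots,x_{i-1},0,x_i,x_{i+1},\ldots)}{x_i}\in\mathbb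 Z[\mathbf x].$$ Let $\widehat{\mathbf t}_i=(t_1,\ldots,t_{i-1},t_{i+1},\ldots)$. **Polynomials.** The *double forest polynomials* are the unique family of polynomials $\mathfrak P_F(\mathbf x;\mathbf t)\in\mathbb Z[\mathbf t][\mathbf x]$, $F\in\mathsf{Forest}$, homogeneous in the variables $\mathbf x,\mathbf t$ together, such that $\mathfrak P_\emptyset(\mathbf t;\mathbf t)=1$, $\mathfrak P_F(\mathbf t;\mathbf t)=0$ for $F\ne\emptyset$, and, for all $F$ and $i$, $\mathsf E_i\mathfrak P_F(\mathbf x;\mathbf t)=\mathfrak P_{F/i}(\mathbf x;\widehat{\mathbf t}_i)$ if $i\in\operatorname{Qdes}(F)$ and $\mathsf E_i\mathfrak P_F(\mathbf x;\mathbf t)=0$ otherwise. The (ordinary) *forest polynomials* are the unique family of homogeneous polynomials $\mathfrak P_F(\mathbf x)\in\mathbb Z[\mathbf x]$, $F\in\mathsf{Forest}$, such that $\mathfrak P_\emptyset(\mathbf x)=1$ and, for all $F$ and $i$, $\mathsf T_i\mathfrak P_F=\mathfrak P_{F/i}$ if $i\in\operatorname{Qdes}(F)$ and $\mathsf T_i\mathfrak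 P_F=0$ otherwise. **Corollary 4.5.** Both families exist and are unique, and: * for every $F\in\mathsf{Forest}$, $\mathfrak P_F(\mathbf x;\mathbf 0)=\mathfrak P_F(\mathbf x)$; * the family $\{\mathfrak P_F(\mathbf x;\mathbf t)\mid F\in\mathsf{Forest}\}$ is a $\mathbb Z[\mathbf t]$-basis of $\mathbb Z[\mathbf t][\mathbf x]$; * for every $n\ge 0$, the family $\{\mathfrak P_F(\mathbf x;\mathbf t)\mid F\in\mathsf{Forest},\ \operatorname{Qdes}(F)\subset\{1,\ldots,n\}\}$ is a $\mathbb Z[\mathbf t]$-basis of $\mathbb Z[\mathbf t][x_1,\ldots,x_n]$. -/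

import Mathlib

/-! Indexing convention: the positive integers `1, 2, 3, …` which number the variables `x`, the
variables `t`, the trees of an indexed forest and its leaves are represented by `0, 1, 2, …`;
so `X 0` is the first variable, and the set `[n] = {1, …, n}` becomes `Set.Iio n`. -/

namespace DoubleForest

/-! ### Indexed forests -/

/-- An indexed forest: a sequence of binary plane trees, all but finitely many of which are the
trivial tree `∗ = BinaryTree.nil`. (In `BinaryTree Unit`, `nil` is a leaf and `node` an internal
node with a left and a right child.) -/
@[ext]
structure IndexedForest where
  tree : ℕ → BinaryTree Unit
  finite_nontrivial : {k | tree k ≠ BinaryTree.nil}.Finite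

/-- For a tree whose leaves are numbered consecutively from left to right, starting with `a`:
the set of the flags `ρ(v)`, with `v` running over the terminal nodes (the internal nodes whose
two children are leaves). The flag of a terminal node is the number of its left leaf. -/
def treeQdes (a : ℕ) : BinaryTree Unit → Set ℕ
  | .nil => ∅
  | .node _ l r =>
      if l = .nil ∧ r = .nil then {a}
      else treeQdes a l ∪ treeQdes (a + l.numLeaves) r

/-- For a tree whose leaves are numbered consecutively from left to right, starting with `a`:
delete (that is, replace by a leaf) the terminal node with flag `i`, if there is one. -/
def treeTrim (i a : ℕ) : BinaryTree Unit → BinaryTree Unit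
  | .nil => .nil
  | .node u l r =>
      if l = .nil ∧ r = .nil then (if a = i then .nil else .node u l r)
      else .node u (treeTrim i a l) (treeTrim i (a + l.numLeaves) r)

namespace IndexedForest

/-- The empty forest: all trees are trivial. -/
def empty : IndexedForest where
  tree _ := .nil
  finite_nontrivial := by simp

/-- The number of the leftmost leaf of the `k`-th tree, the leaves of the whole forest being
numbered consecutively from left to right. -/
def firstLeaf (F : IndexedForest) (k : ℕ) : ℕ :=
  ∑ j ∈ Finset.range k, (F.tree j).numLeaves

/-- `Qdes F`, the set of the flags `ρ_F(v)` of the terminal nodes `v` of `F`. -/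
def qdes (F : IndexedForest) : Set ℕ :=
  ⋃ k, treeQdes (F.firstLeaf k) (F.tree k)

/-- The trimmed forest `F / i` (of interest for `i ∈ Qdes F`): the terminal node with flag `i`
is deleted. -/
def trim (F : IndexedForest) (i : ℕ) : IndexedForest where
  tree k := treeTrim i (F.firstLeaf k) (F.tree k)
  finite_nontrivial := by
    refine F.finite_nontrivial.subset fun k hk h => hk ?_
    simp [h, treeTrim]

end IndexedForest

/-! ### Polynomials, equivariant trimming operations -/

/-- The ring `ℤ[t]`, with `t = (t₁, t₂, …)`; also used for `ℤ[x]`. -/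
abbrev Poly : Type := MvPolynomial ℕ ℤ

/-- The ring `ℤ[t][x]`. The variable `x_i` is `X i`, the variable `t_i` is `C (X i)`. -/
abbrev PolyTX : Type := MvPolynomial ℕ Poly

open MvPolynomial

/-- `R_i^- f = f(x₁, …, x_{i-1}, t_i, x_i, x_{i+1}, …; t)`. -/
noncomputable def rMinus (i : ℕ) : PolyTX →ₐ[Poly] PolyTX :=
  aeval fun j => if j < i then X j else if j = i then C (X i) else X (j - 1)

/-- `R_i^+ f = f(x₁, …, x_{i-1}, x_i, t_i, x_{i+1}, …; t)`. -/
noncomputable def rPlus (i : ℕ) : PolyTX →ₐ[Poly] PolyTX :=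
  aeval fun j => if j ≤ i then X j else if j = i + 1 then C (X i) else X (j - 1)

theorem dvd_rPlus_sub_rMinus (i : ℕ) (f : PolyTX) :
    (X i - C (X i) : PolyTX) ∣ rPlus i f - rMinus i f := by
  induction f using MvPolynomial.induction_on with
  | C a => simp [rPlus, rMinus]
  | add p q hp hq =>
    rw [map_add, map_add, add_sub_add_comm]
    exact dvd_add hp hq
  | mul_X p j hp =>
    have hj : (X i - C (X i) : PolyTX) ∣ rPlus i (X j) - rMinus i (X j) := by
      simp only [rPlus, rMinus, aeval_X]
      rcases lt_trichotomy j i with h | h | h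
      · simp [h, h.le]
      · simp [h]
      · by_cases h' : j = i + 1
        · subst h'
          simpa using dvd_sub_comm.1 (dvd_refl (X i - C (X i) : PolyTX))
        · simp [h', not_le.2 h, not_lt.2 h.le, h.ne']
    have e : rPlus i (p * X j) - rMinus i (p * X j)
        = (rPlus i p - rMinus i p) * rPlus i (X j)
          + rMinus i p * (rPlus i (X j) - rMinus i (X j)) := by
      rw [map_mul, map_mul]; ring
    rw [e]
    exact dvd_add (hp.mul_right _) (hj.mul_left _)

/-- The equivariant trimming operation `E_i f = (R_i^+ f - R_i^- f) / (x_i - t_i)`. -/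
noncomputable def eqTrim (i : ℕ) (f : PolyTX) : PolyTX :=
  Classical.choose (dvd_rPlus_sub_rMinus i f)

theorem eqTrim_spec (i : ℕ) (f : PolyTX) :
    rPlus i f - rMinus i f = (X i - C (X i)) * eqTrim i f :=
  Classical.choose_spec (dvd_rPlus_sub_rMinus i f)

/-- `f(x; t) ↦ f(x; t̂_i)`, where `t̂_i = (t₁, …, t_{i-1}, t_{i+1}, …)`. -/
noncomputable def hatT (i : ℕ) : PolyTX →+* PolyTX :=
  MvPolynomial.map
    (rename (fun j => if j < i then j else j + 1) : Poly →ₐ[ℤ] Poly).toRingHom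

/-- `f(x; t) ↦ f(t; t)`. -/
noncomputable def evalT : PolyTX →+* Poly := MvPolynomial.eval fun j => X j

/-- `f(x; t) ↦ f(x; 0)`. -/
noncomputable def setTZero : PolyTX →+* Poly :=
  MvPolynomial.map (MvPolynomial.eval fun _ => (0 : ℤ))

/-- `f` is homogeneous, with respect to the total degree in all the variables `x` and `t`. -/
def IsHomog (f : PolyTX) : Prop :=
  ∃ d : ℕ, ((sumAlgEquiv ℤ ℕ ℕ).symm f).IsHomogeneous d

/-! ### Double forest polynomials -/

/-- The characterization of the family of the double forest polynomials. -/
structure IsDoubleForestFamily (D : IndexedForest → PolyTX) : Prop where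
  homog : ∀ F, IsHomog (D F)
  evalT_empty : evalT (D .empty) = 1
  evalT_ne : ∀ F, F ≠ .empty → evalT (D F) = 0
  eqTrim_mem : ∀ F, ∀ i ∈ F.qdes, eqTrim i (D F) = hatT i (D (F.trim i))
  eqTrim_notMem : ∀ F, ∀ i ∉ F.qdes, eqTrim i (D F) = 0

/-- The double forest polynomials `𝔓_F(x; t)`: the unique family with the above properties. -/
noncomputable def doubleForestPoly : IndexedForest → PolyTX :=
  Classical.epsilon IsDoubleForestFamily

/-! ### Ordinary forest polynomials -/

/-- The Bergeron–Sottile map `R_i f = f(x₁, …, x_{i-1}, 0, x_i, x_{i+1}, …)`. -/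
noncomputable def bs (i : ℕ) : Poly →ₐ[ℤ] Poly :=
  aeval fun j => if j < i then X j else if j = i then 0 else X (j - 1)

theorem dvd_bs_sub_bs (i : ℕ) (f : Poly) : (X i : Poly) ∣ bs (i + 1) f - bs i f := by
  induction f using MvPolynomial.induction_on with
  | C a => simp [bs]
  | add p q hp hq =>
    rw [map_add, map_add, add_sub_add_comm]
    exact dvd_add hp hq
  | mul_X p j hp =>
    have hj : (X i : Poly) ∣ bs (i + 1) (X j) - bs i (X j) := by
      simp only [bs, aeval_X]
      rcases lt_trichotomy j i with h | h | h
      · simp [h, Nat.lt_succ_of_lt h]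
      · simp [h]
      · by_cases h' : j = i + 1
        · subst h'
          simp
        · have h1 : ¬ j < i + 1 := by omega
          simp [h', h1, not_lt.2 h.le, h.ne']
    have e : bs (i + 1) (p * X j) - bs i (p * X j)
        = (bs (i + 1) p - bs i p) * bs (i + 1) (X j)
          + bs i p * (bs (i + 1) (X j) - bs i (X j)) := by
      rw [map_mul, map_mul]; ring
    rw [e]
    exact dvd_add (hp.mul_right _) (hj.mul_left _)

/-- The trimming operation `T_i f = (R_{i+1} f - R_i f) / x_i`. -/
noncomputable def ordTrim (i : ℕ) (f : Poly) : Poly :=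
  Classical.choose (dvd_bs_sub_bs i f)

theorem ordTrim_spec (i : ℕ) (f : Poly) :
    bs (i + 1) f - bs i f = X i * ordTrim i f :=
  Classical.choose_spec (dvd_bs_sub_bs i f)

/-- The characterization of the family of the (ordinary) forest polynomials. -/
structure IsForestFamily (P : IndexedForest → Poly) : Prop where
  homog : ∀ F, ∃ d : ℕ, (P F).IsHomogeneous d
  empty : P .empty = 1
  ordTrim_mem : ∀ F, ∀ i ∈ F.qdes, ordTrim i (P F) = P (F.trim i)
  ordTrim_notMem : ∀ F, ∀ i ∉ F.qdes, ordTrim i (P F) = 0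

/-- The forest polynomials `𝔓_F(x)`: the unique family with the above properties. -/
noncomputable def forestPoly : IndexedForest → Poly :=
  Classical.epsilon IsForestFamily

/-- `ℤ[t][x₁, …, x_n]`, as a `ℤ[t]`-submodule of `ℤ[t][x]`. -/
noncomputable def polyTXn (n : ℕ) : Submodule Poly PolyTX :=
  Subalgebra.toSubmodule (MvPolynomial.supported Poly (Set.Iio n))

end DoubleForest

/-!
For a forest `F`, apply to `f` the operations `E_i` along any sequence of trimmings from `F` to the
empty forest, dropping the used-up variable `t_i` each time, and set `x = t` in the end. The
resulting functional does not depend on the sequence of trimmings, because the relation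
`T_k T_i = T_i T_{k+1}` for `i < k` between the operations mirrors the relation between the
creations of terminal nodes. As the operations lower the degree and only the constants are killed
by all of them, these functionals separate polynomials, and the double forest polynomials are
exactly their dual basis; for `t = 0` one obtains the forest polynomials. Over every ring of
coefficients and for every sequence `t` the dual basis exists by induction on the forest: a family
`g` with `T_k g_i = T_i g_{k+1}` for `i < k` and `g_i = 0` for `i > m` is integrated by peeling off
`(x_m - t_m) g_m`. Homogeneity follows from uniqueness: on `𝔓_F(2x; 2t)` and on `2^|F| 𝔓_F(x; t)`
all the functionals take the same values.
-/

namespace DoubleForest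

open BinaryTree

/-! ### Growing forests -/

/-- The number of the leaf `a` after the leaf `i` has been split into two leaves; for `a = i`,
the number of the left one of the two. -/
def bump (i a : ℕ) : ℕ := if i < a then a + 1 else a

/-- For a tree whose leaves are numbered consecutively from left to right, starting with `a`:
replace the leaf `i`, if there is one, by a terminal node. -/
def treeGrow (i a : ℕ) : BinaryTree Unit → BinaryTree Unit
  | .nil => if a = i then .node () .nil .nil else .nil
  | .node u l r => .node u (treeGrow i a l) (treeGrow i (a + l.numLeaves) r)

theorem bump_of_le {i a : ℕ} (h : a ≤ i) : bump i a = a := if_neg h.not_gt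

theorem bump_of_lt {i a : ℕ} (h : i < a) : bump i a = a + 1 := if_pos h

theorem treeGrow_eq_nil {i a : ℕ} {T : BinaryTree Unit} (h : treeGrow i a T = .nil) :
    T = .nil ∧ a ≠ i := by
  cases T with
  | nil => exact ⟨rfl, fun h' => by simp [treeGrow, h'] at h⟩
  | node u l r => simp [treeGrow] at h

theorem treeGrow_of_lt {i a : ℕ} (h : i < a) (T : BinaryTree Unit) : treeGrow i a T = T := by
  induction T generalizing a with
  | nil => exact if_neg h.ne'
  | node u l r hl hr => rw [treeGrow, hl h, hr (h.trans_le (Nat.le_add_right _ _))]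

theorem bump_add_numLeaves_treeGrow (i a : ℕ) (T : BinaryTree Unit) :
    bump i a + (treeGrow i a T).numLeaves = bump i (a + T.numLeaves) := by
  induction T generalizing a with
  | nil =>
    simp only [treeGrow, bump]
    split_ifs <;> simp only [numLeaves] at * <;> omega
  | node u l r hl hr => rw [treeGrow, numLeaves, numLeaves, ← add_assoc, hl, hr, add_assoc]

theorem treeGrow_treeGrow {i k : ℕ} (hik : i < k) (a : ℕ) (T : BinaryTree Unit) :
    treeGrow i (bump k a) (treeGrow k a T) = treeGrow (k + 1) (bump i a) (treeGrow i a T) := by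
  induction T generalizing a with
  | nil =>
    rcases eq_or_ne a k with rfl | hk
    · simp [treeGrow, bump_of_le, bump_of_lt hik, hik.ne', show a + 1 ≠ i by omega]
    rcases eq_or_ne a i with rfl | hi
    · simp [treeGrow, bump_of_le hik.le, bump_of_le le_rfl, hk, show a ≠ k + 1 by omega]
    · simp only [treeGrow, if_neg hk, if_neg hi, bump]
      rw [if_neg, if_neg] <;> split_ifs <;> omega
  | node u l r hl hr =>
    simp only [treeGrow]
    rw [bump_add_numLeaves_treeGrow, bump_add_numLeaves_treeGrow, hl, hr]

theorem treeQdes_nonempty {T : BinaryTree Unit} (h : T ≠ .nil) (a : ℕ) :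
    (treeQdes a T).Nonempty := by
  induction T generalizing a with
  | nil => exact absurd rfl h
  | node u l r hl hr =>
    rw [treeQdes]
    split_ifs with hlr
    · exact Set.singleton_nonempty _
    · rcases not_and_or.1 hlr with hl' | hr'
      · exact (hl hl' _).inl
      · exact (hr hr' _).inr

theorem treeQdes_bounds {i a : ℕ} {T : BinaryTree Unit} (h : i ∈ treeQdes a T) :
    a ≤ i ∧ i + 1 < a + T.numLeaves := by
  induction T generalizing a with
  | nil => simp [treeQdes] at h
  | node u l r hl hr =>
    have := l.numLeaves_pos
    have := r.numLeaves_pos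
    rw [treeQdes] at h
    rw [numLeaves]
    split_ifs at h
    · obtain rfl : i = a := h
      omega
    · rcases h with h | h
      · have := hl h
        omega
      · have := hr h
        omega

theorem mem_treeQdes_treeGrow {i a : ℕ} {T : BinaryTree Unit}
    (h : i ∈ Set.Ico a (a + T.numLeaves)) : i ∈ treeQdes a (treeGrow i a T) := by
  induction T generalizing a with
  | nil =>
    obtain rfl : a = i := by
      simp only [numLeaves, Set.mem_Ico] at h
      omega
    simp [treeGrow, treeQdes]
  | node u l r hl hr =>
    simp only [numLeaves, Set.mem_Ico] at h
    rw [treeGrow, treeQdes]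
    split_ifs with hlr
    · obtain ⟨rfl, h1⟩ := treeGrow_eq_nil hlr.1
      obtain ⟨rfl, h2⟩ := treeGrow_eq_nil hlr.2
      simp only [numLeaves] at h h2
      omega
    rcases lt_or_ge i (a + l.numLeaves) with hi | hi
    · exact Or.inl (hl ⟨h.1, hi⟩)
    · have h1 := bump_add_numLeaves_treeGrow i a l
      rw [bump_of_le h.1, bump_of_le hi] at h1
      rw [h1]
      exact Or.inr (hr ⟨hi, by omega⟩)

theorem mem_treeQdes_of_mem_treeGrow {i k a : ℕ} (hik : i ≤ k) {T : BinaryTree Unit}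
    (h : k + 1 ∈ treeQdes (bump i a) (treeGrow i a T)) : i < k ∧ k ∈ treeQdes a T := by
  induction T generalizing a with
  | nil =>
    rw [treeGrow] at h
    split_ifs at h with ha
    · simp only [ha, treeQdes, bump_of_le le_rfl, and_self, if_true, Set.mem_singleton_iff] at h
      omega
    · simp [treeQdes] at h
  | node u l r hl hr =>
    rw [treeGrow, treeQdes] at h
    rw [treeQdes]
    split_ifs at h with hlr
    · obtain ⟨rfl, h1⟩ := treeGrow_eq_nil hlr.1
      obtain ⟨rfl, -⟩ := treeGrow_eq_nil hlr.2
      rw [Set.mem_singleton_iff, bump] at h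
      rw [if_pos ⟨rfl, rfl⟩, Set.mem_singleton_iff]
      split_ifs at h <;> omega
    · rw [bump_add_numLeaves_treeGrow] at h
      have hsub : k ∈ treeQdes a l ∪ treeQdes (a + l.numLeaves) r →
          k ∈ if l = .nil ∧ r = .nil then {a}
            else treeQdes a l ∪ treeQdes (a + l.numLeaves) r := fun hk => by
        rwa [if_neg]
        rintro ⟨rfl, rfl⟩
        simp [treeQdes] at hk
      exact h.elim (fun h => (hl h).imp_right (hsub ∘ Or.inl))
        fun h => (hr h).imp_right (hsub ∘ Or.inr)

theorem treeTrim_treeGrow (i a : ℕ) (T : BinaryTree Unit) :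
    treeTrim i (bump i a) (treeGrow i a T) = T := by
  induction T generalizing a with
  | nil =>
    rcases eq_or_ne a i with rfl | h
    · simp [treeGrow, treeTrim, bump_of_le]
    · simp [treeGrow, treeTrim, h]
  | node u l r hl hr =>
    rw [treeGrow, treeTrim]
    split_ifs with h h'
    · have := (treeGrow_eq_nil h.1).2
      rw [bump] at h'
      split_ifs at h' <;> omega
    · rw [h.1, h.2, (treeGrow_eq_nil h.1).1, (treeGrow_eq_nil h.2).1]
    · rw [bump_add_numLeaves_treeGrow, hl, hr]

theorem mem_treeQdes_left_right {i a : ℕ} {l r : BinaryTree Unit} {u : Unit}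
    (hlr : ¬(l = .nil ∧ r = .nil))
    (h : i ∈ Set.Ico a (a + (node u l r).numLeaves) → i ∈ treeQdes a (.node u l r)) :
    (i ∈ Set.Ico a (a + l.numLeaves) → i ∈ treeQdes a l) ∧
      (i ∈ Set.Ico (a + l.numLeaves) (a + l.numLeaves + r.numLeaves) →
        i ∈ treeQdes (a + l.numLeaves) r) := by
  rw [treeQdes, if_neg hlr, numLeaves, ← add_assoc] at h
  constructor <;> intro hi <;> rw [Set.mem_Ico] at hi
  · refine (h ⟨hi.1, by omega⟩).resolve_right fun h' => ?_
    have := treeQdes_bounds h'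
    omega
  · refine (h ⟨by omega, hi.2⟩).resolve_left fun h' => ?_
    have := treeQdes_bounds h'
    omega

theorem bump_add_numLeaves_treeTrim {i a : ℕ} {T : BinaryTree Unit}
    (h : i ∈ Set.Ico (bump i a) (bump i a + T.numLeaves) → i ∈ treeQdes (bump i a) T) :
    bump i (a + (treeTrim i (bump i a) T).numLeaves) = bump i a + T.numLeaves := by
  induction T generalizing a with
  | nil =>
    have ha : a ≠ i := by
      rintro rfl
      simp [bump_of_le, treeQdes, numLeaves] at h
    simp only [treeTrim, numLeaves, bump]
    split_ifs <;> omega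
  | node u l r hl hr =>
    by_cases hlr : l = .nil ∧ r = .nil
    · obtain ⟨rfl, rfl⟩ := hlr
      rcases eq_or_ne a i with rfl | ha
      · simp [treeTrim, bump, numLeaves]
      · have ha' : a + 1 ≠ i := by
          rintro rfl
          simp [bump_of_le, treeQdes, numLeaves] at h
        have hai : bump i a ≠ i := by grind [bump]
        rw [treeTrim, if_pos ⟨rfl, rfl⟩, if_neg hai]
        grind [bump, numLeaves]
    · obtain ⟨h1, h2⟩ := mem_treeQdes_left_right hlr h
      rw [← hl h1] at h2
      rw [treeTrim, if_neg hlr, numLeaves, numLeaves, ← add_assoc, ← add_assoc, ← hl h1, hr h2]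

theorem treeGrow_treeTrim {i a : ℕ} {T : BinaryTree Unit}
    (h : i ∈ Set.Ico (bump i a) (bump i a + T.numLeaves) → i ∈ treeQdes (bump i a) T) :
    treeGrow i a (treeTrim i (bump i a) T) = T := by
  induction T generalizing a with
  | nil =>
    refine if_neg ?_
    rintro rfl
    simp [bump_of_le, treeQdes, numLeaves] at h
  | node u l r hl hr =>
    by_cases hlr : l = .nil ∧ r = .nil
    · obtain ⟨rfl, rfl⟩ := hlr
      rcases eq_or_ne a i with rfl | ha
      · simp [treeTrim, treeGrow, bump]
      · have ha' : a + 1 ≠ i := by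
          rintro rfl
          simp [bump_of_le, treeQdes, numLeaves] at h
        have hai : bump i a ≠ i := by grind [bump]
        simp [treeTrim, treeGrow, hai, ha, ha', numLeaves]
    · obtain ⟨h1, h2⟩ := mem_treeQdes_left_right hlr h
      rw [← bump_add_numLeaves_treeTrim h1] at h2
      rw [treeTrim, if_neg hlr, treeGrow, hl h1, ← bump_add_numLeaves_treeTrim h1, hr h2]

namespace IndexedForest

theorem firstLeaf_succ (F : IndexedForest) (k : ℕ) :
    F.firstLeaf (k + 1) = F.firstLeaf k + (F.tree k).numLeaves :=
  Finset.sum_range_succ _ _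

theorem firstLeaf_strictMono (F : IndexedForest) : StrictMono F.firstLeaf :=
  strictMono_nat_of_lt_succ fun k => by
    rw [firstLeaf_succ]
    exact Nat.lt_add_of_pos_right (F.tree k).numLeaves_pos

theorem mem_qdes {F : IndexedForest} {i : ℕ} :
    i ∈ F.qdes ↔ ∃ k, i ∈ treeQdes (F.firstLeaf k) (F.tree k) :=
  Set.mem_iUnion

theorem mem_treeQdes_of_mem_qdes {F : IndexedForest} {i : ℕ} (hi : i ∈ F.qdes) {k : ℕ}
    (hk : i ∈ Set.Ico (F.firstLeaf k) (F.firstLeaf (k + 1))) :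
    i ∈ treeQdes (F.firstLeaf k) (F.tree k) := by
  obtain ⟨m, hm⟩ := mem_qdes.1 hi
  have hm' := treeQdes_bounds hm
  rw [← firstLeaf_succ] at hm'
  have hmk : m < k + 1 := F.firstLeaf_strictMono.lt_iff_lt.1 (hm'.1.trans_lt hk.2)
  have hkm : k < m + 1 := F.firstLeaf_strictMono.lt_iff_lt.1 (hk.1.trans_lt (by omega))
  rwa [show k = m by omega]

theorem qdes_empty : empty.qdes = ∅ := by simp [qdes, empty, treeQdes]

theorem qdes_nonempty {F : IndexedForest} (h : F ≠ empty) : F.qdes.Nonempty := by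
  obtain ⟨k, hk⟩ : ∃ k, F.tree k ≠ .nil := by
    by_contra! h'
    exact h (IndexedForest.ext (funext h'))
  obtain ⟨i, hi⟩ := treeQdes_nonempty hk (F.firstLeaf k)
  exact ⟨i, mem_qdes.2 ⟨k, hi⟩⟩

theorem bddAbove_qdes (F : IndexedForest) : BddAbove F.qdes := by
  obtain ⟨m, hm⟩ := F.finite_nontrivial.bddAbove
  refine ⟨F.firstLeaf (m + 1), fun i hi => ?_⟩
  obtain ⟨k, hk⟩ := mem_qdes.1 hi
  have hkm : k ≤ m := hm fun h : F.tree k = .nil => by simp [h, treeQdes] at hk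
  have hle := F.firstLeaf_strictMono.monotone (Nat.add_le_add_right hkm 1)
  have hlt := treeQdes_bounds hk
  rw [firstLeaf_succ F k] at hle
  omega

/-- The forest obtained by replacing the leaf `i` by a terminal node. -/
def grow (i : ℕ) (F : IndexedForest) : IndexedForest where
  tree k := treeGrow i (F.firstLeaf k) (F.tree k)
  finite_nontrivial := by
    refine (F.finite_nontrivial.union (Set.finite_Iic i)).subset fun k hk => ?_
    by_contra! h
    rw [Set.mem_union, not_or, Set.mem_Iic, not_le] at h
    refine hk ?_
    rw [treeGrow_of_lt (h.2.trans_le F.firstLeaf_strictMono.le_apply)]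
    simpa using h.1

theorem firstLeaf_grow (i : ℕ) (F : IndexedForest) (k : ℕ) :
    (grow i F).firstLeaf k = bump i (F.firstLeaf k) := by
  induction k with
  | zero => simp [firstLeaf, bump]
  | succ k ih => rw [firstLeaf_succ, ih, firstLeaf_succ, ← bump_add_numLeaves_treeGrow]; rfl

theorem tree_grow (i : ℕ) (F : IndexedForest) (k : ℕ) :
    (grow i F).tree k = treeGrow i (F.firstLeaf k) (F.tree k) := rfl

theorem tree_trim (F : IndexedForest) (i k : ℕ) :
    (F.trim i).tree k = treeTrim i (F.firstLeaf k) (F.tree k) := rfl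

theorem trim_grow (i : ℕ) (F : IndexedForest) : (grow i F).trim i = F := by
  ext k
  rw [tree_trim, firstLeaf_grow, tree_grow, treeTrim_treeGrow]

theorem grow_injective (i : ℕ) : Function.Injective (grow i) :=
  Function.LeftInverse.injective (g := (trim · i)) (trim_grow i)

theorem grow_grow {i k : ℕ} (hik : i < k) (F : IndexedForest) :
    grow i (grow k F) = grow (k + 1) (grow i F) := by
  ext m
  simp only [tree_grow, firstLeaf_grow, treeGrow_treeGrow hik]

theorem mem_qdes_grow (i : ℕ) (F : IndexedForest) : i ∈ (grow i F).qdes := by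
  obtain ⟨k, hk, hk'⟩ : ∃ k, F.firstLeaf k ≤ i ∧ i < F.firstLeaf (k + 1) :=
    Order.IsNormal.exists_map_le_lt_map_succ
      ⟨F.firstLeaf_strictMono, fun h => absurd h Order.not_isSuccLimit_of_isSuccArchimedean⟩
      (Nat.zero_le i)
  refine mem_qdes.2 ⟨k, ?_⟩
  rw [firstLeaf_grow, bump_of_le hk, tree_grow]
  exact mem_treeQdes_treeGrow ⟨hk, by rwa [← firstLeaf_succ]⟩

theorem grow_ne_of_notMem_qdes {i : ℕ} {F : IndexedForest} (hi : i ∉ F.qdes)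
    (G : IndexedForest) : grow i G ≠ F := by
  rintro rfl
  exact hi (mem_qdes_grow i G)

theorem mem_qdes_of_mem_qdes_grow {i k : ℕ} (hik : i ≤ k) {F : IndexedForest}
    (h : k + 1 ∈ (grow i F).qdes) : i < k ∧ k ∈ F.qdes := by
  obtain ⟨m, hm⟩ := mem_qdes.1 h
  rw [firstLeaf_grow] at hm
  exact (mem_treeQdes_of_mem_treeGrow hik hm).imp_right fun hk => mem_qdes.2 ⟨m, hk⟩

theorem bump_firstLeaf_trim {i : ℕ} {F : IndexedForest} (hi : i ∈ F.qdes) (k : ℕ) :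
    bump i ((F.trim i).firstLeaf k) = F.firstLeaf k := by
  induction k with
  | zero => simp [firstLeaf, bump]
  | succ k ih =>
    have hk := mem_treeQdes_of_mem_qdes hi (k := k)
    rw [firstLeaf_succ F, ← ih] at hk
    rw [firstLeaf_succ, tree_trim, ← ih, bump_add_numLeaves_treeTrim hk, ih, firstLeaf_succ]

theorem grow_trim {i : ℕ} {F : IndexedForest} (hi : i ∈ F.qdes) : grow i (F.trim i) = F := by
  ext k
  have hk := mem_treeQdes_of_mem_qdes hi (k := k)
  rw [firstLeaf_succ, ← bump_firstLeaf_trim hi] at hk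
  rw [tree_grow, tree_trim, ← bump_firstLeaf_trim hi, treeGrow_treeTrim hk]

theorem eq_trim_iff {i : ℕ} {F G : IndexedForest} (hi : i ∈ F.qdes) :
    G = F.trim i ↔ grow i G = F := by
  rw [← (grow_injective i).eq_iff, grow_trim hi]

theorem exists_eq_grow_grow {i j : ℕ} (hij : i < j) {F : IndexedForest} (hi : i ∈ F.qdes)
    (hj : j ∈ F.qdes) : ∃ k G, i < k ∧ j = k + 1 ∧ F = grow i (grow k G) := by
  obtain ⟨k, rfl⟩ : ∃ k, j = k + 1 := ⟨j - 1, by omega⟩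
  rw [← grow_trim hi] at hj
  obtain ⟨hik, hk⟩ := mem_qdes_of_mem_qdes_grow (by omega) hj
  exact ⟨k, (F.trim i).trim k, hik, rfl, by rw [grow_trim hk, grow_trim hi]⟩

/-- The number of internal nodes. -/
noncomputable def size (F : IndexedForest) : ℕ := ∑ᶠ k, (F.tree k).numNodes

theorem eventually_firstLeaf_eq (F : IndexedForest) :
    ∀ᶠ k in Filter.atTop, F.firstLeaf k = k + F.size := by
  obtain ⟨m, hm⟩ := F.finite_nontrivial.bddAbove
  filter_upwards [Filter.eventually_gt_atTop m] with k hk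
  have hsupp : Function.support (fun j => (F.tree j).numNodes) ⊆ Finset.range k := fun j hj => by
    have : F.tree j ≠ .nil := fun h => by simp [h] at hj
    simpa using (hm this).trans_lt hk
  rw [size, finsum_eq_sum_of_support_subset _ hsupp, firstLeaf]
  simp only [numLeaves_eq_numNodes_succ, Finset.sum_add_distrib, Finset.sum_const,
    Finset.card_range, smul_eq_mul, mul_one, add_comm]

theorem size_empty : empty.size = 0 := by simp [size, empty]

theorem size_grow (i : ℕ) (F : IndexedForest) : (grow i F).size = F.size + 1 := by
  obtain ⟨k, hF, hG, hk⟩ := ((eventually_firstLeaf_eq F).and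
    ((eventually_firstLeaf_eq (grow i F)).and (Filter.eventually_gt_atTop i))).exists
  rw [firstLeaf_grow, bump_of_lt (hk.trans_le F.firstLeaf_strictMono.le_apply)] at hG
  omega

theorem size_trim {i : ℕ} {F : IndexedForest} (hi : i ∈ F.qdes) :
    (F.trim i).size + 1 = F.size := by
  rw [← size_grow i, grow_trim hi]

@[elab_as_elim]
theorem trim_induction {p : IndexedForest → Prop} (h : ∀ F, (∀ i ∈ F.qdes, p (F.trim i)) → p F)
    (F : IndexedForest) : p F := by
  induction hn : F.size using Nat.strong_induction_on generalizing F with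
  | _ n ih =>
    exact h F fun i hi => ih _ (Nat.lt_of_succ_le (hn ▸ (size_trim hi).le)) _ rfl

@[elab_as_elim]
theorem grow_induction {p : IndexedForest → Prop} (empty : p empty)
    (grow : ∀ i F, p F → p (grow i F)) (F : IndexedForest) : p F := by
  induction F using trim_induction with
  | _ F ih =>
    by_cases hF : F = .empty
    · rwa [hF]
    · obtain ⟨i, hi⟩ := qdes_nonempty hF
      exact grow_trim hi ▸ grow i _ (ih i hi)

end IndexedForest

open MvPolynomial

/-! ### Trimming operations at an arbitrary parameter -/

section Trimming

variable {R S : Type*} [CommRing R] [CommRing S]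

section

variable {σ : Type*}

theorem totalDegree_lt_totalDegree_X_sub_C_mul (i : σ) (a : R) {g : MvPolynomial σ R}
    (hg : g ≠ 0) : g.totalDegree < ((X i - C a) * g).totalDegree := by
  obtain ⟨b, hb, hdeg⟩ := g.support.exists_mem_eq_sup (by simpa) fun s => s.sum fun _ e => e
  have hsum : ((Finsupp.single i 1 + b).sum fun _ e => e) = g.totalDegree + 1 := by
    rw [Finsupp.sum_add_index' (fun _ => rfl) (fun _ _ _ => rfl), totalDegree, hdeg,
      Finsupp.sum_single_index rfl, add_comm]
  have htop : coeff (Finsupp.single i 1 + b) g = 0 := by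
    refine notMem_support_iff.1 fun h => ?_
    have := le_totalDegree h
    omega
  refine Nat.lt_of_succ_le (hsum.symm.le.trans (le_totalDegree (mem_support_iff.2 ?_)))
  rw [sub_mul, coeff_sub, coeff_X_mul, coeff_C_mul, htop, mul_zero, sub_zero]
  exact mem_support_iff.1 hb

theorem isRegular_X_sub_C (i : σ) (a : R) : IsRegular (X i - C a : MvPolynomial σ R) := by
  refine Commute.isRegular_iff (Commute.all _) |>.2 ?_
  refine isLeftRegular_iff_right_eq_zero_of_mul.2 fun g hg => by_contra fun hne => ?_
  have := totalDegree_lt_totalDegree_X_sub_C_mul i a hne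
  rw [hg, totalDegree_zero] at this
  exact this.not_ge (Nat.zero_le _)

end

/-- The Bergeron–Sottile map `f ↦ f(x₁, …, x_{i-1}, a, x_i, x_{i+1}, …)` with the value `a`
inserted at position `i`. -/
noncomputable def insertAt (i : ℕ) (a : R) : MvPolynomial ℕ R →ₐ[R] MvPolynomial ℕ R :=
  aeval fun j => if j < i then X j else if j = i then C a else X (j - 1)

theorem insertAt_X_of_lt {i j : ℕ} (h : j < i) (a : R) : insertAt i a (X j) = X j := by
  simp [insertAt, h]

theorem insertAt_X_self (i : ℕ) (a : R) : insertAt i a (X i) = C a := by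
  simp [insertAt]

theorem insertAt_X_succ {i j : ℕ} (h : i ≤ j) (a : R) : insertAt i a (X (j + 1)) = X j := by
  simp [insertAt, show ¬j + 1 < i by omega, show j + 1 ≠ i by omega]

theorem insertAt_C (i : ℕ) (a r : R) : insertAt i a (C r) = C r :=
  (insertAt i a).commutes r

theorem insertAt_insertAt {i k : ℕ} (h : i ≤ k) (a b : R) (f : MvPolynomial ℕ R) :
    insertAt i a (insertAt (k + 1) b f) = insertAt k b (insertAt i a f) := by
  suffices (insertAt i a).comp (insertAt (k + 1) b) = (insertAt k b).comp (insertAt i a) from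
    DFunLike.congr_fun this f
  ext1 j
  simp only [AlgHom.comp_apply]
  rcases lt_trichotomy j i with hj | rfl | hj
  · rw [insertAt_X_of_lt (by omega), insertAt_X_of_lt hj, insertAt_X_of_lt (by omega)]
  · rw [insertAt_X_of_lt (by omega), insertAt_X_self, insertAt_C]
  obtain ⟨j, rfl⟩ := Nat.exists_eq_succ_of_ne_zero hj.ne_bot
  rw [insertAt_X_succ (Nat.le_of_lt_succ hj)]
  rcases lt_trichotomy j k with hk | rfl | hk
  · rw [insertAt_X_of_lt (by omega), insertAt_X_of_lt hk, insertAt_X_succ (by omega)]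
  · rw [insertAt_X_self, insertAt_X_self, insertAt_C]
  · rw [insertAt_X_succ (by omega)]
    obtain ⟨j, rfl⟩ := Nat.exists_eq_succ_of_ne_zero hk.ne_bot
    rw [insertAt_X_succ (by omega), insertAt_X_succ (by omega)]

theorem map_insertAt (φ : R →+* S) (i : ℕ) (a : R) (f : MvPolynomial ℕ R) :
    map φ (insertAt i a f) = insertAt i (φ a) (map φ f) := by
  rw [insertAt, insertAt, map_aeval, aeval_eq_eval₂Hom, coe_eval₂Hom, coe_eval₂Hom, eval₂_map]
  congr 1
  · ext; simp
  · ext1 j; split_ifs <;> simp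

theorem totalDegree_insertAt_le (i : ℕ) (a : R) (f : MvPolynomial ℕ R) :
    (insertAt i a f).totalDegree ≤ f.totalDegree := by
  rw [insertAt, aeval_def, eval₂_eq]
  refine totalDegree_finsetSum_le fun d hd => ?_
  calc (C (coeff d f) * ∏ j ∈ d.support, _ ^ d j : MvPolynomial ℕ R).totalDegree
    _ ≤ ∑ j ∈ d.support, ((if j < i then X j else if j = i then C a else X (j - 1) :
          MvPolynomial ℕ R) ^ d j).totalDegree := by
        refine (totalDegree_mul _ _).trans ?_
        rw [totalDegree_C, zero_add]
        exact totalDegree_finsetProd _ _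
    _ ≤ d.sum fun _ e => e := by
        refine Finset.sum_le_sum fun j _ => (totalDegree_pow _ _).trans ?_
        refine (Nat.mul_le_mul_left _ (?_ : _ ≤ 1)).trans (mul_one _).le
        split_ifs
        exacts [(isHomogeneous_X R _).totalDegree_le, by simp, (isHomogeneous_X R _).totalDegree_le]
    _ ≤ f.totalDegree := le_totalDegree hd

theorem insertAt_mem_supported {n i : ℕ} (h : i ≤ n) (a : R) {f : MvPolynomial ℕ R}
    (hf : f ∈ supported R (Set.Iio (n + 1))) : insertAt i a f ∈ supported R (Set.Iio n) := by
  suffices supported R (Set.Iio (n + 1)) ≤ (supported R (Set.Iio n)).comap (insertAt i a) from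
    this hf
  refine Algebra.adjoin_le ?_
  rintro _ ⟨j, hj, rfl⟩
  rw [Set.mem_Iio] at hj
  refine Subalgebra.mem_comap _ _ _ |>.2 ?_
  rcases lt_trichotomy j i with hji | rfl | hji
  · rw [insertAt_X_of_lt hji]
    exact Algebra.subset_adjoin ⟨j, hji.trans_le h, rfl⟩
  · rw [insertAt_X_self]
    exact Subalgebra.algebraMap_mem _ a
  · obtain ⟨j, rfl⟩ := Nat.exists_eq_succ_of_ne_zero hji.ne_bot
    rw [insertAt_X_succ (Nat.le_of_lt_succ hji)]
    exact Algebra.subset_adjoin ⟨j, Nat.lt_of_succ_lt_succ hj, rfl⟩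

theorem insertAt_of_mem_supported {n i : ℕ} (h : n ≤ i) (a : R) {f : MvPolynomial ℕ R}
    (hf : f ∈ supported R (Set.Iio n)) : insertAt i a f = f := by
  refine AlgHom.adjoin_le_equalizer (insertAt i a) (AlgHom.id R _) ?_ hf
  rintro _ ⟨j, hj, rfl⟩
  exact insertAt_X_of_lt (Set.mem_Iio.1 hj |>.trans_le h) a

theorem dvd_insertAt_sub_insertAt (i : ℕ) (a : R) (f : MvPolynomial ℕ R) :
    X i - C a ∣ insertAt (i + 1) a f - insertAt i a f := by
  let π := Ideal.Quotient.mkₐ R (Ideal.span {(X i - C a : MvPolynomial ℕ R)})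
  have hπ : π (X i) = π (C a) :=
    Ideal.Quotient.eq.2 (Ideal.subset_span rfl)
  suffices π.comp (insertAt (i + 1) a) = π.comp (insertAt i a) from
    Ideal.mem_span_singleton.1 (Ideal.Quotient.eq.1 (DFunLike.congr_fun this f))
  ext1 j
  simp only [AlgHom.comp_apply]
  rcases lt_trichotomy j i with h | rfl | h
  · rw [insertAt_X_of_lt (by omega), insertAt_X_of_lt h]
  · rw [insertAt_X_of_lt (by omega), insertAt_X_self, hπ]
  · obtain ⟨j, rfl⟩ := Nat.exists_eq_succ_of_ne_zero h.ne_bot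
    rw [insertAt_X_succ (Nat.le_of_lt_succ h)]
    rcases (Nat.le_of_lt_succ h).eq_or_lt with rfl | h'
    · rw [insertAt_X_self, hπ]
    · rw [insertAt_X_succ h']

/-- The trimming operation at the parameter `a`, that is
`f ↦ (f(x₁, …, x_i, a, x_{i+1}, …) - f(x₁, …, x_{i-1}, a, x_i, …)) / (x_i - a)`. It specializes
to `E_i` for `a = t_i` and to `T_i` for `a = 0`. -/
noncomputable def trimAt (i : ℕ) (a : R) : MvPolynomial ℕ R →ₗ[R] MvPolynomial ℕ R where
  toFun f := (dvd_insertAt_sub_insertAt i a f).choose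
  map_add' f g := (isRegular_X_sub_C i a).left <| by
    simp only [mul_add]
    rw [← (dvd_insertAt_sub_insertAt i a (f + g)).choose_spec,
      ← (dvd_insertAt_sub_insertAt i a f).choose_spec,
      ← (dvd_insertAt_sub_insertAt i a g).choose_spec, map_add, map_add, add_sub_add_comm]
  map_smul' r f := (isRegular_X_sub_C i a).left <| by
    simp only [RingHom.id_apply, mul_smul_comm]
    rw [← (dvd_insertAt_sub_insertAt i a (r • f)).choose_spec,
      ← (dvd_insertAt_sub_insertAt i a f).choose_spec, map_smul, map_smul, smul_sub]

theorem X_sub_C_mul_trimAt (i : ℕ) (a : R) (f : MvPolynomial ℕ R) :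
    (X i - C a) * trimAt i a f = insertAt (i + 1) a f - insertAt i a f :=
  (dvd_insertAt_sub_insertAt i a f).choose_spec.symm

theorem trimAt_eq {i : ℕ} {a : R} {f g : MvPolynomial ℕ R}
    (h : insertAt (i + 1) a f - insertAt i a f = (X i - C a) * g) : trimAt i a f = g :=
  (isRegular_X_sub_C i a).left ((X_sub_C_mul_trimAt i a f).trans h)

theorem trimAt_C (i : ℕ) (a r : R) : trimAt i a (C r) = 0 :=
  trimAt_eq (by rw [insertAt_C, insertAt_C, sub_self, mul_zero])

theorem trimAt_trimAt {i k : ℕ} (h : i < k) (a b : R) (f : MvPolynomial ℕ R) :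
    trimAt k b (trimAt i a f) = trimAt i a (trimAt (k + 1) b f) := by
  apply (isRegular_X_sub_C i a).left
  apply (isRegular_X_sub_C k b).left
  have hi : ∀ j g, i < j → (X i - C a) * insertAt j b g = insertAt j b ((X i - C a) * g) :=
    fun j g hj => by rw [map_mul, map_sub, insertAt_X_of_lt hj, insertAt_C]
  have hk : ∀ j g, j ≤ k →
      (X k - C b) * insertAt j a g = insertAt j a ((X (k + 1) - C b) * g) :=
    fun j g hj => by rw [map_mul, map_sub, insertAt_X_succ hj, insertAt_C]
  simp only
  rw [mul_left_comm, X_sub_C_mul_trimAt, X_sub_C_mul_trimAt, mul_sub, mul_sub,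
    hi _ _ (by omega), hi _ _ h, hk _ _ h, hk _ _ h.le]
  simp only [X_sub_C_mul_trimAt, map_sub]
  rw [insertAt_insertAt (show i ≤ k + 1 by omega), insertAt_insertAt (show i + 1 ≤ k + 1 by omega),
    insertAt_insertAt h, insertAt_insertAt h.le]
  ring

theorem map_trimAt (φ : R →+* S) (i : ℕ) (a : R) (f : MvPolynomial ℕ R) :
    map φ (trimAt i a f) = trimAt i (φ a) (map φ f) := by
  refine (trimAt_eq ?_).symm
  rw [← map_insertAt, ← map_insertAt, ← map_sub, ← X_sub_C_mul_trimAt]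
  simp only [map_mul, map_sub, map_X, map_C]

theorem totalDegree_trimAt_lt {i : ℕ} {a : R} {f : MvPolynomial ℕ R} (h : trimAt i a f ≠ 0) :
    (trimAt i a f).totalDegree < f.totalDegree := by
  refine (totalDegree_lt_totalDegree_X_sub_C_mul i a h).trans_le ?_
  rw [X_sub_C_mul_trimAt]
  exact (totalDegree_sub _ _).trans
    (max_le (totalDegree_insertAt_le _ a f) (totalDegree_insertAt_le _ a f))

theorem trimAt_of_mem_supported {n i : ℕ} (h : n ≤ i) (a : R) {f : MvPolynomial ℕ R}
    (hf : f ∈ supported R (Set.Iio n)) : trimAt i a f = 0 :=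
  trimAt_eq (by rw [insertAt_of_mem_supported h a hf, insertAt_of_mem_supported (by omega) a hf,
    sub_self, mul_zero])

theorem exists_mem_supported_Iio (f : MvPolynomial ℕ R) : ∃ n, f ∈ supported R (Set.Iio n) := by
  obtain ⟨m, hm⟩ := f.vars.bddAbove
  exact ⟨m + 1, mem_supported.2 fun i hi => Nat.lt_succ_of_le (hm hi)⟩

theorem mem_supported_of_trimAt_eq_zero {n : ℕ} (t : ℕ → R) {f : MvPolynomial ℕ R}
    (h : ∀ i, n ≤ i → trimAt i (t i) f = 0) : f ∈ supported R (Set.Iio n) := by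
  obtain ⟨m, hm⟩ := exists_mem_supported_Iio f
  induction m with
  | zero => exact supported_mono (Set.Iio_subset_Iio n.zero_le) hm
  | succ m ih =>
    rcases le_or_gt (m + 1) n with hn | hn
    · exact supported_mono (Set.Iio_subset_Iio hn) hm
    have hf := X_sub_C_mul_trimAt m (t m) f
    rw [h m (Nat.le_of_lt_succ hn), mul_zero, insertAt_of_mem_supported le_rfl _ hm, eq_comm,
      sub_eq_zero] at hf
    exact ih (hf ▸ insertAt_mem_supported le_rfl (t m) hm)

end Trimming

/-! ### The functionals dual to the forest polynomials -/

open IndexedForest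

/-- The sequence `(t₁, …, t_{i-1}, t_{i+1}, …)`. -/
def removeAt {R : Type*} (i : ℕ) (t : ℕ → R) (j : ℕ) : R := t (if j < i then j else j + 1)

theorem removeAt_of_lt {R : Type*} {i j : ℕ} (h : j < i) (t : ℕ → R) : removeAt i t j = t j :=
  congrArg t (if_pos h)

theorem removeAt_of_le {R : Type*} {i j : ℕ} (h : i ≤ j) (t : ℕ → R) :
    removeAt i t j = t (j + 1) :=
  congrArg t (if_neg h.not_gt)

theorem removeAt_removeAt {R : Type*} {i k : ℕ} (h : i ≤ k) (t : ℕ → R) :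
    removeAt k (removeAt i t) = removeAt i (removeAt (k + 1) t) := by
  funext j
  simp only [removeAt]
  congr 1
  split_ifs <;> omega

section Functionals

variable {R S : Type*} [CommRing R] [CommRing S]

open Classical in
/-- The functional `f ↦ (E_F f)(t; t)`, where `E_F` is the composition of the trimming operations
along a sequence of trimmings from `F` to the empty forest. The sequence is chosen arbitrarily;
`forestCoeff_of_mem` says that the choice does not matter. -/
noncomputable def forestCoeff (t : ℕ → R) (F : IndexedForest) : MvPolynomial ℕ R →ₗ[R] R :=
  if h : F.qdes.Nonempty then
    forestCoeff (removeAt h.some t) (F.trim h.some) ∘ₗ trimAt h.some (t h.some)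
  else (aeval t).toLinearMap
termination_by F.size
decreasing_by exact Nat.lt_of_succ_le (size_trim h.some_mem).le

theorem forestCoeff_empty (t : ℕ → R) (f : MvPolynomial ℕ R) :
    forestCoeff t .empty f = eval t f := by
  rw [forestCoeff, dif_neg (by simp [qdes_empty])]
  exact congrArg (· f) (aeval_eq_eval t)

theorem forestCoeff_of_mem (t : ℕ → R) {i : ℕ} {F : IndexedForest} (hi : i ∈ F.qdes)
    (f : MvPolynomial ℕ R) :
    forestCoeff t F f = forestCoeff (removeAt i t) (F.trim i) (trimAt i (t i) f) := by
  induction hn : F.size using Nat.strong_induction_on generalizing t i F f with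
  | _ n ih =>
    have swap {a b : ℕ} (hab : a < b) (ha : a ∈ F.qdes) (hb : b ∈ F.qdes) :
        forestCoeff (removeAt a t) (F.trim a) (trimAt a (t a) f) =
          forestCoeff (removeAt b t) (F.trim b) (trimAt b (t b) f) := by
      obtain ⟨k, G, hak, rfl, rfl⟩ := exists_eq_grow_grow hab ha hb
      rw [size_grow] at hn
      rw [trim_grow, grow_grow hak, trim_grow,
        ih _ (by omega) _ (mem_qdes_grow k G) _ rfl,
        ih _ (by rw [← hn]; simp only [size_grow]; omega) _
          (mem_qdes_grow a G) _ rfl,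
        trim_grow, trim_grow, removeAt_removeAt hak.le,
        removeAt_of_le hak.le, removeAt_of_lt (Nat.lt_succ_of_lt hak), trimAt_trimAt hak]
    have hF : F.qdes.Nonempty := ⟨i, hi⟩
    rw [forestCoeff, dif_pos hF, LinearMap.comp_apply]
    rcases lt_trichotomy i hF.some with h | h | h
    · exact (swap h hi hF.some_mem).symm
    · rw [← h]
    · exact swap h hF.some_mem hi

theorem forestCoeff_grow (t : ℕ → R) (i : ℕ) (F : IndexedForest) (f : MvPolynomial ℕ R) :
    forestCoeff t (F.grow i) f = forestCoeff (removeAt i t) F (trimAt i (t i) f) := by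
  rw [forestCoeff_of_mem t (mem_qdes_grow i F), trim_grow]

theorem map_forestCoeff (φ : R →+* S) (t : ℕ → R) (F : IndexedForest) (f : MvPolynomial ℕ R) :
    φ (forestCoeff t F f) = forestCoeff (φ ∘ t) F (map φ f) := by
  induction F using grow_induction generalizing t f with
  | empty =>
    rw [forestCoeff_empty, forestCoeff_empty, eval_map, eval, coe_eval₂Hom, eval₂_comp_left]
    rfl
  | grow i F ih =>
    rw [forestCoeff_grow, forestCoeff_grow, ih, map_trimAt]
    rfl

theorem eq_zero_of_forestCoeff_eq_zero {t : ℕ → R} {f : MvPolynomial ℕ R}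
    (h : ∀ F, forestCoeff t F f = 0) : f = 0 := by
  induction hd : f.totalDegree using Nat.strong_induction_on generalizing t f with
  | _ d ih =>
    have htrim : ∀ i, trimAt i (t i) f = 0 := fun i => by_contra fun hne =>
      hne <| ih _ (hd ▸ totalDegree_trimAt_lt hne) (t := removeAt i t)
        (fun F => by rw [← forestCoeff_grow, h]) rfl
    have hconst : f ∈ supported R (Set.Iio 0) :=
      mem_supported_of_trimAt_eq_zero t fun i _ => htrim i
    rw [show Set.Iio 0 = ∅ from Set.Iio_bot, supported_empty, Algebra.mem_bot] at hconst
    obtain ⟨r, rfl⟩ := hconst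
    have hr := h .empty
    rw [forestCoeff_empty, algebraMap_eq, eval_C] at hr
    rw [hr, map_zero]

theorem ext_forestCoeff {t : ℕ → R} {f g : MvPolynomial ℕ R}
    (h : ∀ F, forestCoeff t F f = forestCoeff t F g) : f = g :=
  sub_eq_zero.1 (eq_zero_of_forestCoeff_eq_zero fun F => by rw [map_sub, h, sub_self])

theorem forestCoeff_of_mem_supported (t : ℕ → R) {n : ℕ} {F : IndexedForest}
    (hF : ¬F.qdes ⊆ Set.Iio n) {f : MvPolynomial ℕ R} (hf : f ∈ supported R (Set.Iio n)) :
    forestCoeff t F f = 0 := by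
  obtain ⟨i, hi, hn⟩ := Set.not_subset.1 hF
  rw [forestCoeff_of_mem t hi, trimAt_of_mem_supported (not_lt.1 hn) _ hf, map_zero]

theorem finite_forestCoeff_ne_zero (t : ℕ → R) (f : MvPolynomial ℕ R) :
    {F | forestCoeff t F f ≠ 0}.Finite := by
  induction hd : f.totalDegree using Nat.strong_induction_on generalizing t f with
  | _ d ih =>
    obtain ⟨n, hn⟩ := exists_mem_supported_Iio f
    have htrim i : {G | forestCoeff (removeAt i t) G (trimAt i (t i) f) ≠ 0}.Finite := by
      by_cases h0 : trimAt i (t i) f = 0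
      · simp [h0]
      · exact ih _ (hd ▸ totalDegree_trimAt_lt h0) _ _ rfl
    refine ((Set.finite_singleton empty).union ((Set.finite_Iio n).biUnion
      fun i _ => (htrim i).image (grow i))).subset fun F hF => ?_
    by_cases h0 : F = .empty
    · exact Or.inl h0
    obtain ⟨i, hi⟩ := qdes_nonempty h0
    have hqdes : F.qdes ⊆ Set.Iio n := by_contra fun h =>
      hF (forestCoeff_of_mem_supported t h hn)
    refine Or.inr (Set.mem_biUnion (hqdes hi) ⟨F.trim i, ?_, grow_trim hi⟩)
    exact fun h => hF ((forestCoeff_of_mem t hi f).trans h)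

end Functionals

section Duality

variable {R S : Type*} [CommRing R] [CommRing S]

open Classical in
/-- The functional of `F` takes the value `1` at `f`, and the functionals of all other forests
vanish at `f`. The double forest polynomial of `F` is the `f` with this property when
`t = (t₁, t₂, …)` consists of the variables, the forest polynomial of `F` is the one for `t = 0`. -/
def IsDualTo (t : ℕ → R) (F : IndexedForest) (f : MvPolynomial ℕ R) : Prop :=
  ∀ G, forestCoeff t G f = if G = F then 1 else 0

namespace IsDualTo

variable {t : ℕ → R} {F : IndexedForest} {f : MvPolynomial ℕ R}

theorem unique (h : IsDualTo t F f) {g : MvPolynomial ℕ R} (hg : IsDualTo t F g) : f = g :=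
  ext_forestCoeff fun G => (h G).trans (hg G).symm

theorem map (h : IsDualTo t F f) (φ : R →+* S) : IsDualTo (φ ∘ t) F (map φ f) := fun G => by
  rw [← map_forestCoeff, h G, apply_ite φ, map_one, map_zero]

theorem trimAt_of_mem (h : IsDualTo t F f) {i : ℕ} (hi : i ∈ F.qdes) :
    IsDualTo (removeAt i t) (F.trim i) (trimAt i (t i) f) := fun G => by
  classical
  rw [← forestCoeff_grow, h]
  exact if_congr (eq_trim_iff hi).symm rfl rfl

theorem trimAt_eq_zero (h : IsDualTo t F f) {i : ℕ} (hi : i ∉ F.qdes) : trimAt i (t i) f = 0 :=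
  eq_zero_of_forestCoeff_eq_zero (t := removeAt i t) fun G => by
    rw [← forestCoeff_grow, h, if_neg (grow_ne_of_notMem_qdes hi G)]

theorem mem_supported (h : IsDualTo t F f) {n : ℕ} (hF : F.qdes ⊆ Set.Iio n) :
    f ∈ supported R (Set.Iio n) :=
  mem_supported_of_trimAt_eq_zero t fun _ hi => h.trimAt_eq_zero fun hi' => (hF hi').not_ge hi

end IsDualTo

theorem isDualTo_of_trimAt {t : ℕ → R} {F : IndexedForest} {f : MvPolynomial ℕ R}
    (hempty : F = .empty → eval t f = 1) (hne : F ≠ .empty → eval t f = 0)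
    (hmem : ∀ i ∈ F.qdes, IsDualTo (removeAt i t) (F.trim i) (trimAt i (t i) f))
    (hnotMem : ∀ i ∉ F.qdes, trimAt i (t i) f = 0) : IsDualTo t F f := fun G => by
  cases G using grow_induction with
  | empty =>
    rw [forestCoeff_empty]
    by_cases hF : F = .empty
    · rw [if_pos hF.symm, hempty hF]
    · rw [if_neg (Ne.symm hF), hne hF]
  | grow i G =>
    rw [forestCoeff_grow]
    by_cases hi : i ∈ F.qdes
    · classical
      rw [hmem i hi]
      exact if_congr (eq_trim_iff hi) rfl rfl
    · rw [hnotMem i hi, map_zero, if_neg (grow_ne_of_notMem_qdes hi G)]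

theorem isDualTo_empty_one (t : ℕ → R) : IsDualTo t .empty 1 :=
  isDualTo_of_trimAt (fun _ => map_one _) (fun h => (h rfl).elim)
    (fun i hi => by simp [qdes_empty] at hi) fun i _ => trimAt_C i (t i) 1

theorem dualBases_of_isDualTo {t : ℕ → R} {D : IndexedForest → MvPolynomial ℕ R}
    (h : ∀ F, IsDualTo t F (D F)) : Module.DualBases D (forestCoeff t) where
  eval_same F := by rw [h F, if_pos rfl]
  eval_of_ne _ F hne := (h F _).trans (if_neg hne)
  total := ext_forestCoeff
  finite := finite_forestCoeff_ne_zero t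

theorem dualBases_supported_of_isDualTo {t : ℕ → R} {D : IndexedForest → MvPolynomial ℕ R}
    (h : ∀ F, IsDualTo t F (D F)) (n : ℕ) :
    Module.DualBases
      (fun F : {F : IndexedForest // F.qdes ⊆ Set.Iio n} =>
        (⟨D F, (h F).mem_supported F.2⟩ :
          Subalgebra.toSubmodule (supported R (Set.Iio n))))
      (fun F => (forestCoeff t F).domRestrict _) where
  eval_same F := (dualBases_of_isDualTo h).eval_same F
  eval_of_ne G F hne := (dualBases_of_isDualTo h).eval_of_ne (Subtype.coe_ne_coe.2 hne)
  total {f g} hfg := Subtype.ext <| ext_forestCoeff (t := t) fun F => by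
    by_cases hF : F.qdes ⊆ Set.Iio n
    · exact hfg ⟨F, hF⟩
    · rw [forestCoeff_of_mem_supported t hF f.2, forestCoeff_of_mem_supported t hF g.2]
  finite f := (finite_forestCoeff_ne_zero t f).preimage Subtype.val_injective.injOn

end Duality

/-! ### Existence -/

section Existence

variable {R : Type*} [CommRing R]

theorem exists_trimAt_eq (t : ℕ → R) {g : ℕ → MvPolynomial ℕ R} {m : ℕ}
    (hfin : ∀ i, m ≤ i → g i = 0)
    (hcomm : ∀ i k, i < k → trimAt k (t (k + 1)) (g i) = trimAt i (t i) (g (k + 1))) :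
    ∃ f, ∀ i, trimAt i (t i) f = g i := by
  induction m generalizing g with
  | zero => exact ⟨0, fun i => by rw [map_zero, hfin i i.zero_le]⟩
  | succ m ih =>
    have hgm : g m ∈ supported R (Set.Iio (m + 1)) :=
      mem_supported_of_trimAt_eq_zero (fun k => t (k + 1)) fun k hk => by
        rw [hcomm m k hk, hfin (k + 1) (by omega), map_zero]
    -- `h` has the trimmings `g m` at `m` and `0` beyond, so subtracting it shortens the family.
    let h := (X m - C (t m)) * g m
    have hh : h ∈ supported R (Set.Iio (m + 1)) :=
      mul_mem (sub_mem (Algebra.subset_adjoin ⟨m, Nat.lt_succ_self m, rfl⟩)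
        (Subalgebra.algebraMap_mem _ _)) hgm
    have htrim : trimAt m (t m) h = g m := trimAt_eq <| by
      rw [insertAt_of_mem_supported le_rfl _ hh, map_mul (insertAt m (t m)), map_sub,
        insertAt_X_self, insertAt_C, sub_self, zero_mul, sub_zero]
    obtain ⟨f, hf⟩ := ih (g := fun i => g i - trimAt i (t i) h)
      (fun i hi => by
        rcases hi.eq_or_lt with rfl | hi
        · rw [htrim, sub_self]
        · rw [hfin i hi, trimAt_of_mem_supported hi _ hh, sub_self])
      (fun i k hik => by
        rw [map_sub, map_sub, hcomm i k hik, trimAt_trimAt hik])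
    exact ⟨f + h, fun i => by rw [map_add, hf, sub_add_cancel]⟩

theorem exists_isDualTo (t : ℕ → R) (F : IndexedForest) : ∃ f, IsDualTo t F f := by
  induction F using trim_induction generalizing t with
  | _ F ih =>
    by_cases hF : F = .empty
    · exact ⟨1, hF ▸ isDualTo_empty_one t⟩
    classical
    have hg i : ∃ g, ∀ G, forestCoeff (removeAt i t) G g = if grow i G = F then 1 else 0 := by
      by_cases hi : i ∈ F.qdes
      · obtain ⟨g, hg⟩ := ih i hi (removeAt i t)
        exact ⟨g, fun G => by simp only [hg G, eq_trim_iff hi]⟩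
      · exact ⟨0, fun G => by rw [map_zero, if_neg (grow_ne_of_notMem_qdes hi G)]⟩
    choose g hg using hg
    obtain ⟨m, hm⟩ := F.bddAbove_qdes
    obtain ⟨f, hf⟩ : ∃ f, ∀ i, trimAt i (t i) f = g i := by
      refine exists_trimAt_eq t (m := m + 1) (fun i hi => ?_) fun i k hik => ?_
      · refine eq_zero_of_forestCoeff_eq_zero (t := removeAt i t) fun G => ?_
        have hi' : i ∉ F.qdes := fun h => hi.not_gt (Nat.lt_succ_of_le (hm h))
        rw [hg, if_neg (grow_ne_of_notMem_qdes hi' G)]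
      · refine ext_forestCoeff (t := removeAt k (removeAt i t)) fun G => ?_
        rw [← removeAt_of_le hik.le t, ← forestCoeff_grow, hg, removeAt_removeAt hik.le,
          ← removeAt_of_lt (Nat.lt_succ_of_lt hik) t, ← forestCoeff_grow, hg, grow_grow hik]
    refine ⟨f - C (eval t f), fun G => ?_⟩
    cases G using grow_induction with
    | empty => rw [forestCoeff_empty, map_sub, eval_C, sub_self, if_neg (Ne.symm hF)]
    | grow i G => rw [forestCoeff_grow, map_sub, trimAt_C, sub_zero, hf, hg]

end Existence

/-! ### Homogeneity -/

section Homogeneity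

variable {σ R : Type*} [CommRing R]

/-- The substitution `f ↦ f(u x₁, u x₂, …)`. -/
noncomputable def scale (u : R) : MvPolynomial σ R →ₐ[R] MvPolynomial σ R :=
  aeval fun i => C u * X i

theorem scale_X (u : R) (i : σ) : scale u (X i) = C u * X i := aeval_X _ i

theorem scale_C (u r : R) : scale u (C r : MvPolynomial σ R) = C r := (scale u).commutes r

theorem eval_scale (u : R) (t : σ → R) (f : MvPolynomial σ R) :
    eval t (scale u f) = eval (u • t) f := by
  rw [scale, ← coe_aeval_eq_eval, ← coe_aeval_eq_eval]
  refine DFunLike.congr_fun (?_ : (aeval t).comp (aeval _) = aeval (u • t)) f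
  ext1 i
  simp

theorem coeff_scale (u : R) (f : MvPolynomial σ R) (m : σ →₀ ℕ) :
    coeff m (scale u f) = u ^ m.degree * coeff m f := by
  classical
  induction f using MvPolynomial.induction_on' with
  | add p q hp hq => rw [map_add, coeff_add, coeff_add, hp, hq, mul_add]
  | monomial e r =>
    have : scale u (monomial e r) = monomial e (u ^ e.degree * r) := by
      rw [scale, aeval_monomial, algebraMap_eq, monomial_eq, Finsupp.degree_apply, C_mul, C_pow]
      simp only [Finsupp.prod, mul_pow, Finset.prod_mul_distrib, Finset.prod_pow_eq_pow_sum]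
      ring
    rw [this, coeff_monomial, coeff_monomial]
    split_ifs with h
    · rw [h]
    · rw [mul_zero]

theorem isHomogeneous_of_scale_two_eq [IsDomain R] [CharZero R] {f : MvPolynomial σ R} {d : ℕ}
    (h : scale 2 f = (2 : R) ^ d • f) : f.IsHomogeneous d := by
  intro m hm
  have hcoeff := congrArg (coeff m) h
  rw [coeff_scale, coeff_smul, smul_eq_mul] at hcoeff
  have hpow : 2 ^ m.degree = 2 ^ d := by exact_mod_cast mul_right_cancel₀ hm hcoeff
  exact (DFunLike.congr_fun Finsupp.degree_eq_weight_one m).symm.trans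
    (Nat.pow_right_injective le_rfl hpow)

theorem sumAlgEquiv_scale {τ : Type*} (u : R) (p : MvPolynomial (σ ⊕ τ) R) :
    sumAlgEquiv R σ τ (scale u p) =
      scale (C u) (MvPolynomial.map (scale u : MvPolynomial τ R →ₐ[R] MvPolynomial τ R).toRingHom
        (sumAlgEquiv R σ τ p)) := by
  induction p using MvPolynomial.induction_on with
  | C r => simp
  | add p q hp hq => simp only [map_add, hp, hq]
  | mul_X p j hp =>
    rw [map_mul, map_mul, map_mul, map_mul, map_mul, hp]
    rcases j with j | j <;> simp [scale_X]

theorem insertAt_scale (i : ℕ) (a u : R) (f : MvPolynomial ℕ R) :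
    insertAt i a (scale u f) = scale u (insertAt i (u * a) f) := by
  suffices (insertAt i a).comp (scale u) = (scale u).comp (insertAt i (u * a)) from
    DFunLike.congr_fun this f
  ext1 j
  simp only [AlgHom.comp_apply, scale_X, map_mul, insertAt_C]
  rcases lt_trichotomy j i with h | rfl | h
  · rw [insertAt_X_of_lt h, insertAt_X_of_lt h, scale_X]
  · rw [insertAt_X_self, insertAt_X_self, scale_C, C_mul]
  · obtain ⟨j, rfl⟩ := Nat.exists_eq_succ_of_ne_zero h.ne_bot
    rw [insertAt_X_succ (Nat.le_of_lt_succ h), insertAt_X_succ (Nat.le_of_lt_succ h), scale_X]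

theorem trimAt_scale (i : ℕ) (a u : R) (f : MvPolynomial ℕ R) :
    trimAt i a (scale u f) = u • scale u (trimAt i (u * a) f) := by
  apply trimAt_eq
  rw [insertAt_scale, insertAt_scale, ← map_sub, ← X_sub_C_mul_trimAt, map_mul, map_sub, scale_X,
    scale_C, C_mul, smul_eq_C_mul]
  ring

theorem forestCoeff_scale (t : ℕ → R) (u : R) (F : IndexedForest) (f : MvPolynomial ℕ R) :
    forestCoeff t F (scale u f) = u ^ F.size * forestCoeff (u • t) F f := by
  induction F using grow_induction generalizing t f with
  | empty =>
    rw [size_empty, pow_zero, one_mul, forestCoeff_empty, forestCoeff_empty, eval_scale]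
  | grow i F ih =>
    rw [forestCoeff_grow, forestCoeff_grow, trimAt_scale, map_smul, ih, size_grow, pow_succ',
      mul_assoc, smul_eq_mul]
    rfl

theorem IsDualTo.scale_eq {t : ℕ → R} {F : IndexedForest} {f : MvPolynomial ℕ R}
    (h : IsDualTo t F f) {φ : R →+* R} {u : R} (hφ : φ ∘ t = u • t) :
    scale u (MvPolynomial.map φ f) = u ^ F.size • f := by
  refine ext_forestCoeff (t := t) fun G => ?_
  rw [forestCoeff_scale, ← hφ, h.map φ G, map_smul, h G]
  split_ifs with hG
  · rw [hG, smul_eq_mul]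
  · rw [mul_zero, smul_zero]

end Homogeneity

/-! ### The two families -/

theorem rMinus_eq_insertAt (i : ℕ) : rMinus i = insertAt i (X i) := rfl

theorem rPlus_eq_insertAt (i : ℕ) : rPlus i = insertAt (i + 1) (X i) := by
  simp only [rPlus, insertAt, Nat.lt_succ_iff]

theorem eqTrim_eq_trimAt (i : ℕ) (f : PolyTX) : eqTrim i f = trimAt i (X i) f :=
  (trimAt_eq (by rw [← rPlus_eq_insertAt, ← rMinus_eq_insertAt, eqTrim_spec])).symm

theorem ordTrim_eq_trimAt (i : ℕ) (f : Poly) : ordTrim i f = trimAt i 0 f := by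
  have hbs j : bs j = insertAt j 0 := by rw [bs, insertAt, C_0]
  exact (trimAt_eq (by rw [← hbs, ← hbs, ordTrim_spec, C_0, sub_zero])).symm

theorem hatT_eq_map (i : ℕ) :
    ∃ φ : Poly →+* Poly, hatT i = MvPolynomial.map φ ∧ φ ∘ X = removeAt i X :=
  ⟨_, rfl, funext fun j => rename_X _ j⟩

theorem IsDualTo.isHomog {F : IndexedForest} {f : PolyTX} (h : IsDualTo X F f) : IsHomog f := by
  refine ⟨F.size, isHomogeneous_of_scale_two_eq ((sumAlgEquiv ℤ ℕ ℕ).injective ?_)⟩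
  rw [sumAlgEquiv_scale, map_smul, AlgEquiv.apply_symm_apply,
    h.scale_eq (u := C 2) (funext fun j => scale_X 2 j), ← C_pow, ← algebraMap_eq, algebraMap_smul]

theorem IsDualTo.isHomogeneous {F : IndexedForest} {f : Poly} (h : IsDualTo 0 F f) :
    f.IsHomogeneous F.size := by
  have hscale := h.scale_eq (φ := RingHom.id ℤ) (u := 2) (by ext; simp)
  rw [MvPolynomial.map_id] at hscale
  exact isHomogeneous_of_scale_two_eq hscale

theorem IsDoubleForestFamily.isDualTo {D : IndexedForest → PolyTX} (h : IsDoubleForestFamily D)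
    (F : IndexedForest) : IsDualTo X F (D F) := by
  induction F using trim_induction with
  | _ F ih =>
    refine isDualTo_of_trimAt (fun hF => hF ▸ h.evalT_empty) (h.evalT_ne F) (fun i hi => ?_)
      fun i hi => ?_
    · obtain ⟨φ, hφ, hX⟩ := hatT_eq_map i
      rw [← eqTrim_eq_trimAt, h.eqTrim_mem F i hi, hφ, ← hX]
      exact (ih i hi).map φ
    · rw [← eqTrim_eq_trimAt, h.eqTrim_notMem F i hi]

theorem IsForestFamily.ne_zero {P : IndexedForest → Poly} (h : IsForestFamily P)
    (F : IndexedForest) : P F ≠ 0 := by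
  induction F using trim_induction with
  | _ F ih =>
    by_cases hF : F = .empty
    · rw [hF, h.empty]
      exact one_ne_zero
    obtain ⟨i, hi⟩ := qdes_nonempty hF
    intro h0
    exact ih i hi (by rw [← h.ordTrim_mem F i hi, h0, ordTrim_eq_trimAt, map_zero])

theorem IsForestFamily.eval_zero {P : IndexedForest → Poly} (h : IsForestFamily P)
    {F : IndexedForest} (hF : F ≠ .empty) : eval 0 (P F) = 0 := by
  obtain ⟨d, hd⟩ := h.homog F
  obtain ⟨i, hi⟩ := qdes_nonempty hF
  rw [MvPolynomial.eval_zero, constantCoeff_eq]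
  refine hd.coeff_eq_zero fun hd0 => h.ne_zero (F.trim i) ?_
  rw [map_zero] at hd0
  rw [← hd0, ← totalDegree_zero_iff_isHomogeneous, totalDegree_eq_zero_iff_eq_C] at hd
  rw [← h.ordTrim_mem F i hi, ordTrim_eq_trimAt, hd, trimAt_C]

theorem IsForestFamily.isDualTo {P : IndexedForest → Poly} (h : IsForestFamily P)
    (F : IndexedForest) : IsDualTo 0 F (P F) := by
  induction F using trim_induction with
  | _ F ih =>
    refine isDualTo_of_trimAt (fun hF => by rw [hF, h.empty, map_one]) h.eval_zero
      (fun i hi => ?_) fun i hi => ?_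
    · rw [Pi.zero_apply, ← ordTrim_eq_trimAt, h.ordTrim_mem F i hi]
      exact ih i hi
    · rw [Pi.zero_apply, ← ordTrim_eq_trimAt, h.ordTrim_notMem F i hi]

theorem isDoubleForestFamily_of_isDualTo {D : IndexedForest → PolyTX}
    (h : ∀ F, IsDualTo X F (D F)) : IsDoubleForestFamily D where
  homog F := (h F).isHomog
  evalT_empty := (forestCoeff_empty X _).symm.trans ((h .empty .empty).trans (if_pos rfl))
  evalT_ne F hF := (forestCoeff_empty X _).symm.trans ((h F .empty).trans (if_neg hF.symm))
  eqTrim_mem F i hi := by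
    obtain ⟨φ, hφ, hX⟩ := hatT_eq_map i
    rw [eqTrim_eq_trimAt, hφ]
    exact ((h F).trimAt_of_mem hi).unique (hX ▸ (h (F.trim i)).map φ)
  eqTrim_notMem F i hi := by rw [eqTrim_eq_trimAt, (h F).trimAt_eq_zero hi]

theorem isForestFamily_of_isDualTo {P : IndexedForest → Poly}
    (h : ∀ F, IsDualTo 0 F (P F)) : IsForestFamily P where
  homog F := ⟨_, (h F).isHomogeneous⟩
  empty := (h .empty).unique (isDualTo_empty_one 0)
  ordTrim_mem F i hi := by
    rw [ordTrim_eq_trimAt]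
    exact ((h F).trimAt_of_mem hi).unique (h (F.trim i))
  ordTrim_notMem F i hi := by
    rw [ordTrim_eq_trimAt]
    exact (h F).trimAt_eq_zero hi

theorem isDoubleForestFamily_doubleForestPoly : IsDoubleForestFamily doubleForestPoly :=
  Classical.epsilon_spec <| (Classical.axiomOfChoice (exists_isDualTo X)).imp
    fun _ => isDoubleForestFamily_of_isDualTo

theorem isForestFamily_forestPoly : IsForestFamily forestPoly :=
  Classical.epsilon_spec <| (Classical.axiomOfChoice (exists_isDualTo 0)).imp
    fun _ => isForestFamily_of_isDualTo

theorem isDualTo_setTZero_doubleForestPoly (F : IndexedForest) :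
    IsDualTo 0 F (setTZero (doubleForestPoly F)) := by
  have h := (isDoubleForestFamily_doubleForestPoly.isDualTo F).map (eval fun _ => (0 : ℤ))
  rwa [show eval (fun _ => (0 : ℤ)) ∘ X = 0 from funext fun j => eval_X j] at h

end DoubleForest

theorem corollary4p5 :
    -- the double forest polynomials and the forest polynomials are well defined
    (∃! D, DoubleForest.IsDoubleForestFamily D) ∧
    (∃! P, DoubleForest.IsForestFamily P) ∧
    -- specialization at `t = 0`
    (∀ F : DoubleForest.IndexedForest,
      DoubleForest.setTZero (DoubleForest.doubleForestPoly F) = DoubleForest.forestPoly F) ∧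
    -- a basis of `ℤ[t][x]` over `ℤ[t]`
    (∃ b : Module.Basis DoubleForest.IndexedForest DoubleForest.Poly DoubleForest.PolyTX,
      ∀ F, b F = DoubleForest.doubleForestPoly F) ∧
    -- a basis of `ℤ[t][x₁, …, x_n]` over `ℤ[t]`
    (∀ n : ℕ,
      ∃ b : Module.Basis {F : DoubleForest.IndexedForest // F.qdes ⊆ Set.Iio n}
          DoubleForest.Poly (DoubleForest.polyTXn n),
        ∀ F, (b F : DoubleForest.PolyTX) = DoubleForest.doubleForestPoly F) := by
  have hD := DoubleForest.isDoubleForestFamily_doubleForestPoly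
  have hP := DoubleForest.isForestFamily_forestPoly
  refine ⟨⟨_, hD, fun D h => ?_⟩, ⟨_, hP, fun P h => ?_⟩, fun F => ?_, ?_, fun n => ?_⟩
  · exact funext fun F => (h.isDualTo F).unique (hD.isDualTo F)
  · exact funext fun F => (h.isDualTo F).unique (hP.isDualTo F)
  · exact (DoubleForest.isDualTo_setTZero_doubleForestPoly F).unique (hP.isDualTo F)
  · have hbases := DoubleForest.dualBases_of_isDualTo hD.isDualTo
    exact ⟨hbases.basis, congrFun hbases.coe_basis⟩
  · have hbases := DoubleForest.dualBases_supported_of_isDualTo hD.isDualTo n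
    exact ⟨hbases.basis, fun F => congrArg Subtype.val (congrFun hbases.coe_basis F)⟩
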